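/- For a prime $p$ and an integer $u$ with $\gcd(u,p)=1$, let the Fermat quotient $q_p(u)$ be the unique integer with $$q_p(u) \equiv \frac{u^{p-1}-1}{p} \pmod p, \qquad 0 \le q_p(u) \le p-1,$$ and for a positive integer $N$ let $$I_p(N) = \#\{q_p(n) : 1 \le n \le N,\ \gcd(n,p)=1\}.$$ Then for every prime $p$ and every integer $N$ with $2 \le N < p$, $$I_p(N) \ge (1+o(1))\,\frac{N^2}{p(\log N)^2},$$ where $o(1)$ denotes a quantity depending only on $p$ that tends to $0$ as $p \to \infty$; that is, the bound is uniform in $N$. -/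

import Mathlib

/-- The Fermat quotient `q_p(u)`: the representative in `{0, …, p - 1}` of the residue class of
`(u ^ (p - 1) - 1) / p` modulo `p`. For a prime `p` and `u` coprime to `p` the division by `p` is
exact, by Fermat's little theorem; it is only used for such `p` and `u`. -/
def fermatQuotient (p : ℕ) (u : ℤ) : ℤ :=
  ((u ^ (p - 1) - 1) / (p : ℤ)) % (p : ℤ)

/-- The image size `I_p(N) = #{q_p(n) : 1 ≤ n ≤ N, gcd(n, p) = 1}`. -/
def fermatQuotientImageSize (p N : ℕ) : ℕ :=
  (((Finset.Icc 1 N).filter (fun n => Nat.gcd n p = 1)).image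
    (fun n : ℕ => fermatQuotient p (n : ℤ))).card

/-!
Two distinct odd primes `u, v ≤ N < p` with `q_p(u) = q_p(v)` satisfy `u ^ (p - 1) = v ^ (p - 1)`
modulo `p ^ 2`, so both `u / v` and `-u / v` lie among the at most `p - 1` roots of
`w ^ (p - 1) = 1` in the cyclic group `(ℤ/p²)ˣ`. These fractions are pairwise incongruent: cross
multiplication turns a coincidence into a congruence modulo the odd number `p ^ 2` between two odd
integers of absolute value less than `p ^ 2`, whose difference is then divisible by `2 p ^ 2` and
hence zero. So at most `(p - 1) / 2` ordered pairs of distinct odd primes collide, and for a set of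
`k` odd primes Cauchy–Schwarz gives `k ^ 2 ≤ I_p(N) (k + p / 2)`.

The factor `2` gained from the signs means that `k ≥ c N / log N` with some `c > 1 / √2` is enough
for large `N`, so the prime number theorem is not needed. The constant `log 2` from central binomial
coefficients just fails; Chebyshev's method with `(6m)! m! / ((3m)! (2m)!²)` yields every
`c < log 108 / 6 = 0.78…`. For bounded `N` the lower bound is eventually below the trivial `1`.
-/

open Finset Filter
open scoped Nat Topology

theorem exists_tendsto_of_eventually {α β : Type*} [TopologicalSpace β] {l : Filter α} {b : β}
    {P : α → β → Prop} (h : ∀ᶠ a in l, P a b) (h' : ∀ a, ∃ c, P a c) :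
    ∃ f : α → β, Tendsto f l (𝓝 b) ∧ ∀ a, P a (f a) := by
  classical
  choose g hg using h'
  refine ⟨fun a => if P a b then b else g a, ?_, fun a => ?_⟩
  · exact tendsto_const_nhds.congr' (h.mono fun a ha => (if_pos ha).symm)
  · beta_reduce
    split_ifs with ha
    exacts [ha, hg a]

section Chebyshev

/-- Landau's integrality criterion for factorial ratios, relaxed by a slack of `1` for which the lcm
pays. -/
theorem prod_factorial_dvd_prod_factorial_mul_lcmUpto {ι κ : Type*} [Fintype ι] [Fintype κ]
    {a : ι → ℕ} {b : κ → ℕ} {n : ℕ} (ha : ∀ i, a i ≤ n)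
    (hab : ∀ d, ∑ i, a i / d ≤ ∑ j, b j / d + 1) :
    ∏ i, (a i)! ∣ (∏ j, (b j)!) * n.lcmUpto := by
  have prod_a_ne_zero : ∏ i, (a i)! ≠ 0 := prod_ne_zero_iff.2 fun i _ => (a i).factorial_ne_zero
  have prod_b_ne_zero : ∏ j, (b j)! ≠ 0 := prod_ne_zero_iff.2 fun j _ => (b j).factorial_ne_zero
  rw [← Nat.factorization_prime_le_iff_dvd prod_a_ne_zero
    (mul_ne_zero prod_b_ne_zero n.lcmUpto_ne_zero)]
  intro p hp
  have legendre_numerator (i : ι) :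
      (a i)!.factorization p = ∑ e ∈ Ico 1 (p.log n + 1), a i / p ^ e :=
    Nat.factorization_factorial hp (Nat.lt_succ_of_le (Nat.log_mono_right (ha i)))
  have legendre_denominator (j : κ) :
      ∑ e ∈ Ico 1 (p.log n + 1), b j / p ^ e ≤ (b j)!.factorization p := by
    rw [Nat.factorization_factorial hp
      (Nat.lt_succ_of_le (le_max_right (p.log n) (p.log (b j))))]
    exact sum_le_sum_of_subset (Ico_subset_Ico_right (by lia))
  calc (∏ i, (a i)!).factorization p
      = ∑ e ∈ Ico 1 (p.log n + 1), ∑ i, a i / p ^ e := by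
        rw [Nat.factorization_prod_apply fun _ _ => Nat.factorial_ne_zero _, sum_comm]
        exact sum_congr rfl fun i _ => legendre_numerator i
    _ ≤ ∑ e ∈ Ico 1 (p.log n + 1), (∑ j, b j / p ^ e + 1) :=
        sum_le_sum fun e _ => hab (p ^ e)
    _ = ∑ j, ∑ e ∈ Ico 1 (p.log n + 1), b j / p ^ e + p.log n := by
        rw [sum_add_distrib, sum_comm]; simp
    _ ≤ ∑ j, (b j)!.factorization p + p.log n := by
        gcongr with j; exact legendre_denominator j
    _ = ((∏ j, (b j)!) * n.lcmUpto).factorization p := by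
        rw [Nat.factorization_mul prod_b_ne_zero n.lcmUpto_ne_zero,
          Finsupp.add_apply, Nat.factorization_prod_apply fun _ _ => Nat.factorial_ne_zero _,
          Nat.factorization_lcmUpto _ hp]

theorem factorial_six_mul_mul_factorial_dvd (m : ℕ) :
    (6 * m)! * m ! ∣ (3 * m)! * (2 * m)! * (2 * m)! * (6 * m).lcmUpto := by
  have div_eq (c d : ℕ) (hc : 0 < c) (k : ℕ) (hk : c * k = 6) : k * m / d = 6 * m / d / c := by
    rw [Nat.div_div_eq_div_mul, ← hk, mul_comm d, mul_assoc, Nat.mul_div_mul_left _ _ hc]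
  have hdvd := prod_factorial_dvd_prod_factorial_mul_lcmUpto (a := ![6 * m, m])
    (b := ![3 * m, 2 * m, 2 * m]) (n := 6 * m) (by simp [Fin.forall_fin_two]; lia) fun d => by
      have h₃ := div_eq 2 d two_pos 3 rfl
      have h₂ := div_eq 3 d three_pos 2 rfl
      have h₁ := div_eq 6 d (by norm_num) 1 rfl
      suffices 6 * m / d + m / d ≤ 3 * m / d + (2 * m / d + 2 * m / d) + 1 by
        simpa [Fin.sum_univ_succ] using this
      lia
  simpa [Fin.prod_univ_succ, mul_assoc] using hdvd

theorem log_factorial_le {n : ℕ} (hn : n ≠ 0) :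
    Real.log n ! ≤ n * Real.log n - n + Real.log (2 * n) / 2 + 1 := by
  obtain ⟨k, rfl⟩ := Nat.exists_eq_succ_of_ne_zero hn
  have log_stirlingSeq_le : Real.log (Stirling.stirlingSeq (k + 1)) ≤ 1 := by
    have h := Stirling.stirlingSeq'_antitone (Nat.zero_le k)
    simp only [Function.comp_apply, Nat.succ_eq_add_one, zero_add, Stirling.stirlingSeq_one] at h
    rw [Real.log_le_iff_le_exp (Stirling.stirlingSeq'_pos k)]
    exact h.trans (div_le_self (Real.exp_pos 1).le (Real.one_le_sqrt.2 one_le_two))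
  rw [Stirling.log_stirlingSeq_formula, Real.log_div (by positivity) (Real.exp_ne_zero 1),
    Real.log_exp] at log_stirlingSeq_le
  simp only [Nat.succ_eq_add_one]
  linarith

theorem le_log_factorial {n : ℕ} (hn : n ≠ 0) : n * Real.log n - n ≤ Real.log n ! := by
  have h := Stirling.le_log_factorial_stirling hn
  have h₁ : 0 ≤ Real.log n := Real.log_natCast_nonneg n
  have h₂ : 0 ≤ Real.log (2 * Real.pi) := Real.log_nonneg (by linarith [Real.pi_gt_three])
  linarith

theorem log_factorial_six_mul_add_le (m : ℕ) :
    Real.log (6 * m)! + Real.log m ! ≤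
      Real.log (3 * m)! + 2 * Real.log (2 * m)! + Chebyshev.psi (6 * m : ℕ) := by
  have lcm_ne_zero : ((6 * m).lcmUpto : ℝ) ≠ 0 := Nat.cast_ne_zero.2 (Nat.lcmUpto_ne_zero _)
  have hle : ((6 * m)! * m ! : ℝ) ≤ (3 * m)! * (2 * m)! * (2 * m)! * (6 * m).lcmUpto := by
    exact_mod_cast Nat.le_of_dvd
      (by simp [Nat.pos_iff_ne_zero, Nat.factorial_ne_zero, Nat.lcmUpto_ne_zero])
      (factorial_six_mul_mul_factorial_dvd m)
  have hlog := Real.log_le_log (by positivity) hle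
  rw [Real.log_mul (by positivity) (by positivity), Real.log_mul (by positivity) lcm_ne_zero,
    Real.log_mul (by positivity) (by positivity), Real.log_mul (by positivity) (by positivity)]
    at hlog
  rw [Chebyshev.psi_eq_log_lcmUpto]
  linarith

theorem le_psi_six_mul {m : ℕ} (hm : m ≠ 0) :
    m * Real.log 108 - 3 / 2 * Real.log (6 * m) - 3 ≤ Chebyshev.psi (6 * m : ℕ) := by
  have hm₀ : (0 : ℝ) < m := by positivity
  have log_const_mul {c : ℝ} (hc : c ≠ 0) : Real.log (c * m) = Real.log c + Real.log m :=
    Real.log_mul hc hm₀.ne'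
  have log_six : Real.log 6 = Real.log 2 + Real.log 3 := by
    rw [← Real.log_mul two_ne_zero three_ne_zero]; norm_num
  have log_108 : Real.log 108 = 2 * Real.log 2 + 3 * Real.log 3 := by
    rw [show (108 : ℝ) = 2 ^ 2 * 3 ^ 3 by norm_num, Real.log_mul (by norm_num) (by norm_num),
      Real.log_pow, Real.log_pow]
    norm_num
  have log_four_mul_le : Real.log (4 * m) ≤ Real.log (6 * m) :=
    Real.log_le_log (by positivity) (by linarith)
  have lower_one := le_log_factorial hm
  have lower_six :
      6 * m * (Real.log 2 + Real.log 3 + Real.log m) - 6 * m ≤ Real.log (6 * m)! := by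
    have h := le_log_factorial (n := 6 * m) (by simpa)
    rwa [Nat.cast_mul, Nat.cast_ofNat, log_const_mul (by norm_num), log_six] at h
  have upper_three : Real.log (3 * m)! ≤
      3 * m * (Real.log 3 + Real.log m) - 3 * m + Real.log (6 * m) / 2 + 1 := by
    have h := log_factorial_le (n := 3 * m) (by simpa)
    rwa [Nat.cast_mul, Nat.cast_ofNat, show (2 : ℝ) * (3 * m) = 6 * m by ring,
      log_const_mul three_ne_zero] at h
  have upper_two : Real.log (2 * m)! ≤
      2 * m * (Real.log 2 + Real.log m) - 2 * m + Real.log (4 * m) / 2 + 1 := by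
    have h := log_factorial_le (n := 2 * m) (by simpa)
    rwa [Nat.cast_mul, Nat.cast_ofNat, show (2 : ℝ) * (2 * m) = 4 * m by ring,
      log_const_mul two_ne_zero] at h
  rw [log_108]
  linarith [log_factorial_six_mul_add_le m]

theorem eventually_mul_le_psi {c : ℝ} (hc : c < Real.log 108 / 6) :
    ∀ᶠ n : ℕ in atTop, c * n ≤ Chebyshev.psi n := by
  have error_isLittleO : (fun x : ℝ => 3 / 2 * Real.log x + (Real.log 108 + 3)) =o[atTop] id :=
    (Real.isLittleO_log_id_atTop.const_mul_left _).add (Asymptotics.isLittleO_const_id_atTop _)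
  filter_upwards [tendsto_natCast_atTop_atTop.eventually (error_isLittleO.def (sub_pos.2 hc)),
    eventually_ge_atTop 6] with n error_le hn
  have hm : n / 6 ≠ 0 := by lia
  have mul_div_le : (6 * (n / 6 : ℕ) : ℝ) ≤ n := by exact_mod_cast Nat.mul_div_le n 6
  have le_mul_div_add : (n : ℝ) ≤ 6 * (n / 6 : ℕ) + 6 := by
    exact_mod_cast (by lia : n ≤ 6 * (n / 6) + 6)
  have log_le : Real.log (6 * (n / 6 : ℕ)) ≤ Real.log n :=
    Real.log_le_log (by positivity) mul_div_le
  have error_le' : 3 / 2 * Real.log n + (Real.log 108 + 3) ≤ (Real.log 108 / 6 - c) * n := by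
    simpa using (Real.le_norm_self _).trans error_le
  calc c * n = n * (Real.log 108 / 6) - (Real.log 108 / 6 - c) * n := by ring
    _ ≤ (6 * (n / 6 : ℕ) + 6) * (Real.log 108 / 6)
        - (3 / 2 * Real.log (6 * (n / 6 : ℕ)) + (Real.log 108 + 3)) := by
      gcongr
      linarith
    _ = (n / 6 : ℕ) * Real.log 108 - 3 / 2 * Real.log (6 * (n / 6 : ℕ)) - 3 := by ring
    _ ≤ Chebyshev.psi (6 * (n / 6) : ℕ) := le_psi_six_mul hm
    _ ≤ Chebyshev.psi n := Chebyshev.psi_mono (by exact_mod_cast Nat.mul_div_le n 6)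

theorem eventually_mul_div_log_le_card_primesLE_erase {c : ℝ} (hc : c < Real.log 108 / 6) (q : ℕ) :
    ∀ᶠ n : ℕ in atTop, c * (n / Real.log n) ≤ ((n.primesLE).erase q).card := by
  obtain ⟨c', hcc', hc'⟩ := exists_between hc
  filter_upwards [eventually_mul_le_psi hc', eventually_gt_atTop 1,
    tendsto_natCast_atTop_atTop.eventually (Real.isLittleO_log_id_atTop.def (sub_pos.2 hcc'))]
    with n psi_ge hn log_le
  have log_pos : 0 < Real.log n := Real.log_pos (by exact_mod_cast hn)
  have card_le : (n.primeCounting : ℝ) ≤ ((n.primesLE).erase q).card + 1 := by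
    rw [← Nat.primesLE_card_eq_primeCounting]
    exact_mod_cast Nat.sub_le_iff_le_add.1 pred_card_le_card_erase
  have log_le' : Real.log n ≤ (c' - c) * n := by
    simpa using (Real.le_norm_self _).trans log_le
  have psi_le := Chebyshev.psi_le_primeCounting_mul_log n
  rw [← mul_div_assoc, div_le_iff₀ log_pos]
  calc c * n = c' * n - (c' - c) * n := by ring
    _ ≤ n.primeCounting * Real.log n - Real.log n := by
      exact sub_le_sub (psi_ge.trans psi_le) log_le'
    _ ≤ (((n.primesLE).erase q).card + 1) * Real.log n - Real.log n := by gcongr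
    _ = ((n.primesLE).erase q).card * Real.log n := by ring

theorem three_fourths_lt_log_div_six : 3 / 4 < Real.log 108 / 6 := by
  have exp_lt : Real.exp 9 < 108 ^ 2 := by
    calc Real.exp 9 = Real.exp 1 ^ 9 := by rw [← Real.exp_nat_mul]; norm_num
      _ < 2.7182818286 ^ 9 := by gcongr; exact Real.exp_one_lt_d9
      _ < 108 ^ 2 := by norm_num
  have lt_log : 9 < Real.log (108 ^ 2) := (Real.lt_log_iff_exp_lt (by norm_num)).2 exp_lt
  rw [Real.log_pow] at lt_log
  push_cast at lt_log
  linarith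

end Chebyshev

section Collisions

variable {α β : Type*} [DecidableEq β]

/-- The ordered pairs of distinct elements of `s` at which `f` takes the same value. -/
def collisions (f : α → β) (s : Finset α) : Finset (α × α) :=
  {x ∈ s.offDiag | f x.1 = f x.2}

theorem mem_collisions {f : α → β} {s : Finset α} {x : α × α} :
    x ∈ collisions f s ↔ x.1 ∈ s ∧ x.2 ∈ s ∧ x.1 ≠ x.2 ∧ f x.1 = f x.2 := by
  simp only [collisions, mem_filter, mem_offDiag, and_assoc]

theorem sum_sq_card_fiber_eq (f : α → β) (s : Finset α) :
    ∑ y ∈ s.image f, #{x ∈ s | f x = y} ^ 2 = #s + #(collisions f s) := by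
  classical
  have fiber_sq (y : β) :
      #{x ∈ s | f x = y} ^ 2 = #{x ∈ {x ∈ s ×ˢ s | f x.1 = f x.2} | f x.1 = y} := by
    rw [sq, ← card_product]
    congr 1
    grind
  have disjoint_diag : Disjoint s.diag (collisions f s) :=
    (disjoint_diag_offDiag s).mono_right (filter_subset _ _)
  calc ∑ y ∈ s.image f, #{x ∈ s | f x = y} ^ 2 = #{x ∈ s ×ˢ s | f x.1 = f x.2} := by
        rw [card_eq_sum_card_fiberwise (f := fun x => f x.1) (t := s.image f)
          fun x hx => by grind]
        exact sum_congr rfl fun y _ => fiber_sq y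
    _ = #(s.diag ∪ collisions f s) := by
        congr 1
        grind [mem_collisions]
    _ = #s + #(collisions f s) := by rw [card_union_of_disjoint disjoint_diag, diag_card]

theorem sq_card_le_card_image_mul (f : α → β) (s : Finset α) :
    #s ^ 2 ≤ #(s.image f) * (#s + #(collisions f s)) := by
  calc #s ^ 2 = (∑ y ∈ s.image f, #{x ∈ s | f x = y}) ^ 2 := by rw [← card_eq_sum_card_image]
    _ ≤ #(s.image f) * ∑ y ∈ s.image f, #{x ∈ s | f x = y} ^ 2 := mod_cast sq_sum_le_card_mul_sum_sq
    _ = #(s.image f) * (#s + #(collisions f s)) := by rw [sum_sq_card_fiber_eq]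

end Collisions

section PowerCollisions

theorem eq_of_intModEq_of_odd_of_abs_lt {M x y : ℤ} (hM : Odd M) (hx : Odd x) (hy : Odd y)
    (hxM : |x| < M) (hyM : |y| < M) (h : x ≡ y [ZMOD M]) : x = y := by
  have two_dvd : 2 ∣ y - x := (hy.sub_odd hx).two_dvd
  have two_mul_dvd : 2 * M ∣ y - x :=
    (Int.isCoprime_two_left.2 hM).mul_dvd two_dvd h.dvd
  have abs_lt : |y - x| < 2 * M := by linarith [abs_sub y x]
  linarith [Int.eq_zero_of_abs_lt_dvd two_mul_dvd abs_lt]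

theorem eq_and_eq_of_mul_eq_mul_of_isCoprime {a b a' b' : ℤ} (hb : 0 < b) (hb' : 0 < b')
    (hab : IsCoprime a b) (hab' : IsCoprime a' b') (h : a * b' = a' * b) : a = a' ∧ b = b' := by
  refine Rat.div_int_inj hb hb' (Int.isCoprime_iff_nat_coprime.1 hab)
    (Int.isCoprime_iff_nat_coprime.1 hab') ?_
  rw [div_eq_div_iff (by positivity) (by positivity)]
  exact_mod_cast h

/-- The reduced fractions `a / b`, encoded as pairs `(a, b)` with `0 < b`, such that `a` and `b` are
odd and less than `√M` in absolute value, and `b` is invertible modulo `M`. For odd `M` such a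
fraction is determined by its residue class modulo `M`. -/
def smallOddFractions (M : ℕ) : Set (ℤ × ℤ) :=
  {x | Odd x.1 ∧ Odd x.2 ∧ 0 < x.2 ∧ IsCoprime x.1 x.2 ∧ IsCoprime x.2 M ∧
    x.1 ^ 2 < M ∧ x.2 ^ 2 < M}

theorem injOn_smallOddFractions {M : ℕ} (hM : Odd M) :
    Set.InjOn (fun x : ℤ × ℤ => (x.1 : ZMod M) * (x.2 : ZMod M)⁻¹) (smallOddFractions M) := by
  rintro ⟨a, b⟩ ⟨ha, hb, hb₀, hab, hbM, haM, hb_lt⟩ ⟨a', b'⟩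
    ⟨ha', hb', hb₀', hab', hbM', haM', hb_lt'⟩ h
  have abs_mul_lt {x y : ℤ} (hx : x ^ 2 < M) (hy : y ^ 2 < M) : |x * y| < M :=
    abs_lt_of_sq_lt_sq (by rw [mul_pow, sq (M : ℤ)]; gcongr) (by positivity)
  have cross_mul : ((a * b' : ℤ) : ZMod M) = (a' * b : ℤ) := by
    have hbu := ZMod.coe_int_mul_inv_eq_one hbM
    have hbu' := ZMod.coe_int_mul_inv_eq_one hbM'
    push_cast
    linear_combination (b * b' : ZMod M) * h - (a * b' : ZMod M) * hbu + (a' * b : ZMod M) * hbu'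
  have mul_eq_mul : a * b' = a' * b :=
    eq_of_intModEq_of_odd_of_abs_lt (by exact_mod_cast hM) (ha.mul hb') (ha'.mul hb)
      (abs_mul_lt haM hb_lt') (abs_mul_lt haM' hb_lt)
      ((ZMod.intCast_eq_intCast_iff _ _ _).1 cross_mul)
  exact Prod.ext_iff.2 (eq_and_eq_of_mul_eq_mul_of_isCoprime hb₀ hb₀' hab hab' mul_eq_mul)

theorem signed_mem_smallOddFractions {M u v : ℕ} (s : ℤˣ) (hu : Odd u) (hv : Odd v)
    (huv : u.Coprime v) (hvM : v.Coprime M) (hu_lt : u ^ 2 < M) (hv_lt : v ^ 2 < M) :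
    ((s * u, v) : ℤ × ℤ) ∈ smallOddFractions M := by
  have odd_unit : Odd (s : ℤ) := by
    rcases Int.units_eq_one_or s with rfl | rfl <;> decide
  have unit_sq : (s : ℤ) ^ 2 = 1 := by
    rw [← Units.val_pow_eq_pow_val, Int.units_sq, Units.val_one]
  refine ⟨odd_unit.mul ((Int.odd_coe_nat u).2 hu), (Int.odd_coe_nat v).2 hv,
    Int.natCast_pos.2 hv.pos, (isCoprime_mul_unit_left_left s.isUnit _ _).2 huv.isCoprime,
    hvM.isCoprime, ?_, ?_⟩
  · rw [mul_pow, unit_sq, one_mul]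
    exact_mod_cast hu_lt
  · dsimp only
    exact_mod_cast hv_lt

theorem unit_eq_and_eq_of_mul_natCast_eq {s s' : ℤˣ} {u u' : ℕ} (hu : u ≠ 0)
    (h : (s * u : ℤ) = s' * u') : s = s' ∧ u = u' := by
  have u_eq : u = u' := by simpa [Int.natAbs_mul] using congrArg Int.natAbs h
  subst u_eq
  exact ⟨Units.ext (mul_right_cancel₀ (by exact_mod_cast hu) h), rfl⟩

theorem signed_div_pow_eq_one {M k u v : ℕ} (hk : Even k) (s : ℤˣ) (hv : v.Coprime M)
    (h : (u : ZMod M) ^ k = (v : ZMod M) ^ k) :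
    (((s * u : ℤ) : ZMod M) * ((v : ℤ) : ZMod M)⁻¹) ^ k = 1 := by
  have unit_pow : ((s : ℤ) : ZMod M) ^ k = 1 := by
    rcases Int.units_eq_one_or s with rfl | rfl <;> simp [hk.neg_one_pow]
  calc (((s * u : ℤ) : ZMod M) * ((v : ℤ) : ZMod M)⁻¹) ^ k
      = ((s : ℤ) : ZMod M) ^ k * (u : ZMod M) ^ k * ((v : ZMod M)⁻¹) ^ k := by
        push_cast; ring
    _ = ((v : ZMod M) * (v : ZMod M)⁻¹) ^ k := by rw [unit_pow, one_mul, h, mul_pow]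
    _ = 1 := by rw [ZMod.coe_mul_inv_eq_one v hv, one_pow]

theorem two_mul_card_collisions_pow_le {M k : ℕ} [NeZero M] (hM : Odd M) (hk : Even k)
    {S : Finset ℕ} (odd : ∀ n ∈ S, Odd n) (sq_lt : ∀ n ∈ S, n ^ 2 < M)
    (coprime : ∀ n ∈ S, n.Coprime M) (pairwise_coprime : (S : Set ℕ).Pairwise Nat.Coprime) :
    2 * #(collisions (fun n : ℕ => (n : ZMod M) ^ k) S) ≤ #{w : ZMod M | w ^ k = 1} := by
  set C := collisions (fun n : ℕ => (n : ZMod M) ^ k) S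
  let signedFraction : (ℕ × ℕ) × ℤˣ → ℤ × ℤ := fun y => (y.2 * y.1.1, y.1.2)
  let residue : ℤ × ℤ → ZMod M := fun x => x.1 * (x.2 : ZMod M)⁻¹
  have maps_small :
      Set.MapsTo signedFraction ↑(C ×ˢ (univ : Finset ℤˣ)) (smallOddFractions M) := by
    rintro ⟨⟨u, v⟩, s⟩ hy
    obtain ⟨hu, hv, huv, -⟩ := mem_collisions.1 (mem_product.1 (mem_coe.1 hy)).1
    exact signed_mem_smallOddFractions s (odd u hu) (odd v hv) (pairwise_coprime hu hv huv)
      (coprime v hv) (sq_lt u hu) (sq_lt v hv)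
  have injOn_signedFraction : Set.InjOn signedFraction ↑(C ×ˢ (univ : Finset ℤˣ)) := by
    rintro ⟨⟨u, v⟩, s⟩ hy ⟨⟨u', v'⟩, s'⟩ - h
    obtain ⟨hu, -, -, -⟩ := mem_collisions.1 (mem_product.1 (mem_coe.1 hy)).1
    obtain ⟨num_eq, den_eq⟩ := Prod.ext_iff.1 h
    obtain ⟨rfl, rfl⟩ := unit_eq_and_eq_of_mul_natCast_eq (odd u hu).pos.ne' num_eq
    obtain rfl := Nat.cast_inj.1 den_eq
    rfl
  have maps_roots : ∀ y ∈ C ×ˢ (univ : Finset ℤˣ),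
      residue (signedFraction y) ∈ ({w : ZMod M | w ^ k = 1} : Finset (ZMod M)) := by
    rintro ⟨⟨u, v⟩, s⟩ hy
    obtain ⟨-, hv, -, pow_eq⟩ := mem_collisions.1 (mem_product.1 hy).1
    exact mem_filter.2 ⟨mem_univ _, signed_div_pow_eq_one hk s (coprime v hv) pow_eq⟩
  calc 2 * #C = #(C ×ˢ (univ : Finset ℤˣ)) := by
        rw [card_product, card_univ, Fintype.card_units_int, mul_comm]
    _ ≤ #{w : ZMod M | w ^ k = 1} := card_le_card_of_injOn (residue ∘ signedFraction) maps_roots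
        ((injOn_smallOddFractions hM).comp injOn_signedFraction maps_small)

theorem card_filter_pow_eq_one_le {R : Type*} [CommMonoid R] [Fintype R] [DecidableEq R]
    [IsCyclic Rˣ] {k : ℕ} (hk : k ≠ 0) : #{w : R | w ^ k = 1} ≤ k := by
  classical
  refine le_trans ?_ (IsCyclic.card_pow_eq_one_le (α := Rˣ) (Nat.pos_of_ne_zero hk))
  refine card_le_card_of_surjOn Units.val fun w hw => ?_
  have hw : w ^ k = 1 := by simpa using hw
  exact ⟨Units.ofPowEqOne w k hw hk, by simp [Units.pow_ofPowEqOne], rfl⟩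

end PowerCollisions

section FermatQuotient

theorem pow_eq_pow_of_fermatQuotient_eq {p : ℕ} (hp : p.Prime) {u v : ℤ} (hu : IsCoprime u p)
    (hv : IsCoprime v p) (h : fermatQuotient p u = fermatQuotient p v) :
    (u : ZMod (p ^ 2)) ^ (p - 1) = (v : ZMod (p ^ 2)) ^ (p - 1) := by
  have hp₀ : (p : ℤ) ≠ 0 := by exact_mod_cast hp.ne_zero
  obtain ⟨a, ha⟩ := (Int.ModEq.pow_card_sub_one_eq_one hp hu).symm.dvd
  obtain ⟨b, hb⟩ := (Int.ModEq.pow_card_sub_one_eq_one hp hv).symm.dvd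
  simp only [fermatQuotient, ha, hb, Int.mul_ediv_cancel_left _ hp₀] at h
  obtain ⟨c, hc⟩ := Int.ModEq.dvd (show a ≡ b [ZMOD p] from h)
  have modEq : u ^ (p - 1) ≡ v ^ (p - 1) [ZMOD (p ^ 2 : ℕ)] :=
    Int.modEq_of_dvd ⟨c, by push_cast; linear_combination hb - ha + (p : ℤ) * hc⟩
  exact_mod_cast (ZMod.intCast_eq_intCast_iff _ _ _).2 modEq

theorem two_mul_card_collisions_fermatQuotient_le {p : ℕ} (hp : p.Prime) (hp₂ : p ≠ 2)
    {S : Finset ℕ} (odd : ∀ n ∈ S, Odd n) (lt : ∀ n ∈ S, n < p)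
    (pairwise_coprime : (S : Set ℕ).Pairwise Nat.Coprime) :
    2 * #(collisions (fun n : ℕ => fermatQuotient p n) S) ≤ p - 1 := by
  have : NeZero (p ^ 2) := ⟨pow_ne_zero _ hp.ne_zero⟩
  have : IsCyclic (ZMod (p ^ 2))ˣ := ZMod.isCyclic_units_of_prime_pow p hp hp₂ 2
  have coprime (n : ℕ) (hn : n ∈ S) : n.Coprime p :=
    (Nat.coprime_of_lt_prime (odd n hn).pos.ne' (lt n hn) hp).symm
  have subset : collisions (fun n : ℕ => fermatQuotient p n) S ⊆
      collisions (fun n : ℕ => (n : ZMod (p ^ 2)) ^ (p - 1)) S := fun ⟨u, v⟩ h => by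
    obtain ⟨hu, hv, huv, hq⟩ := mem_collisions.1 h
    exact mem_collisions.2 ⟨hu, hv, huv, by
      exact_mod_cast pow_eq_pow_of_fermatQuotient_eq hp (coprime u hu).isCoprime
        (coprime v hv).isCoprime hq⟩
  calc 2 * #(collisions (fun n : ℕ => fermatQuotient p n) S)
      ≤ 2 * #(collisions (fun n : ℕ => (n : ZMod (p ^ 2)) ^ (p - 1)) S) := by
        gcongr
    _ ≤ #{w : ZMod (p ^ 2) | w ^ (p - 1) = 1} :=
        two_mul_card_collisions_pow_le (hp.odd_of_ne_two hp₂).pow (hp.even_sub_one hp₂) odd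
          (fun n hn => by have := lt n hn; gcongr) (fun n hn => (coprime n hn).pow_right 2)
          pairwise_coprime
    _ ≤ p - 1 := card_filter_pow_eq_one_le (Nat.sub_ne_zero_of_lt hp.one_lt)

theorem card_image_le_fermatQuotientImageSize {p N : ℕ} {S : Finset ℕ} (hS : S ⊆ Icc 1 N)
    (coprime : ∀ n ∈ S, n.Coprime p) :
    #(S.image fun n : ℕ => fermatQuotient p n) ≤ fermatQuotientImageSize p N :=
  card_le_card (image_subset_image fun n hn => mem_filter.2 ⟨hS hn, coprime n hn⟩)

theorem sq_card_primesLE_erase_two_le {p N : ℕ} (hp : p.Prime) (hp₂ : p ≠ 2) (hN : N < p) :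
    (#(N.primesLE.erase 2) : ℝ) ^ 2 ≤
      fermatQuotientImageSize p N * (#(N.primesLE.erase 2) + p / 2) := by
  set S := N.primesLE.erase 2
  have mem_S {n : ℕ} (hn : n ∈ S) : n ≠ 2 ∧ n ≤ N ∧ n.Prime := by
    simpa only [S, mem_erase, Nat.mem_primesLE] using hn
  have collisions_le : 2 * #(collisions (fun n : ℕ => fermatQuotient p n) S) ≤ p - 1 :=
    two_mul_card_collisions_fermatQuotient_le hp hp₂
      (fun n hn => (mem_S hn).2.2.odd_of_ne_two (mem_S hn).1)
      (fun n hn => (mem_S hn).2.1.trans_lt hN)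
      (fun u hu v hv huv => (Nat.coprime_primes (mem_S hu).2.2 (mem_S hv).2.2).2 huv)
  have image_le : #(S.image fun n : ℕ => fermatQuotient p n) ≤ fermatQuotientImageSize p N :=
    card_image_le_fermatQuotientImageSize
      (fun n hn => mem_Icc.2 ⟨(mem_S hn).2.2.one_le, (mem_S hn).2.1⟩)
      (fun n hn => (Nat.coprime_primes (mem_S hn).2.2 hp).2 ((mem_S hn).2.1.trans_lt hN).ne)
  have collisions_le_half : (#(collisions (fun n : ℕ => fermatQuotient p n) S) : ℝ) ≤ p / 2 := by
    rw [le_div_iff₀' two_pos]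
    exact_mod_cast collisions_le.trans (Nat.sub_le p 1)
  calc (#S : ℝ) ^ 2
      ≤ #(S.image fun n : ℕ => fermatQuotient p n) *
          (#S + #(collisions (fun n : ℕ => fermatQuotient p n) S)) :=
        mod_cast sq_card_le_card_image_mul _ S
    _ ≤ fermatQuotientImageSize p N * (#S + p / 2) := by gcongr

theorem one_le_fermatQuotientImageSize (p : ℕ) {N : ℕ} (hN : 1 ≤ N) :
    1 ≤ fermatQuotientImageSize p N :=
  card_pos.2 (Nonempty.image ⟨1, by simp [hN]⟩ _)

theorem sq_div_le_of_sq_le_mul {x k p I : ℝ} (hp : 0 < p) (hx : 0 ≤ x) (hxp : x ≤ p / 12)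
    (hxk : 3 / 4 * x ≤ k) (hk : k ^ 2 ≤ I * (k + p / 2)) : x ^ 2 / p ≤ I := by
  have hk₀ : 0 ≤ k := by linarith
  have hxk' : x ≤ 4 / 3 * k := by linarith
  have cross_mul : x ^ 2 * (k + p / 2) ≤ k ^ 2 * p := by
    calc x ^ 2 * (k + p / 2) = x * x * k + x ^ 2 * (p / 2) := by ring
      _ ≤ p / 12 * (4 / 3 * k) * k + (4 / 3 * k) ^ 2 * (p / 2) := by gcongr
      _ = k ^ 2 * p := by ring
  calc x ^ 2 / p ≤ k ^ 2 / (k + p / 2) := (div_le_div_iff₀ hp (by positivity)).2 cross_mul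
    _ ≤ I := (div_le_iff₀ (by positivity)).2 hk

theorem sq_div_le_fermatQuotientImageSize_of_le_card {p N : ℕ} (hp : p.Prime) (hp₂ : p ≠ 2)
    (hN : N < p) (hlog : 12 ≤ Real.log N)
    (hcard : 3 / 4 * ((N : ℝ) / Real.log N) ≤ #(N.primesLE.erase 2)) :
    (N : ℝ) ^ 2 / (p * Real.log N ^ 2) ≤ fermatQuotientImageSize p N := by
  have hp₀ : (0 : ℝ) < p := by exact_mod_cast hp.pos
  have div_log_le : (N : ℝ) / Real.log N ≤ p / 12 := by gcongr
  calc (N : ℝ) ^ 2 / (p * Real.log N ^ 2) = ((N : ℝ) / Real.log N) ^ 2 / p := by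
        rw [div_pow, div_div, mul_comm (p : ℝ)]
    _ ≤ (fermatQuotientImageSize p N : ℝ) :=
        sq_div_le_of_sq_le_mul hp₀ (by positivity) div_log_le hcard
          (sq_card_primesLE_erase_two_le hp hp₂ hN)

theorem eventually_sq_div_mul_sq_log_le_one (N : ℕ) :
    ∀ᶠ p : ℕ in atTop, (N : ℝ) ^ 2 / (p * Real.log N ^ 2) ≤ 1 := by
  filter_upwards [(tendsto_const_div_atTop_nhds_zero_nat
    ((N : ℝ) ^ 2 / Real.log N ^ 2)).eventually_le_const one_pos] with p hp
  rwa [mul_comm, ← div_div]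

theorem theorem11_general :
    ∀ᶠ p : ℕ in atTop, p.Prime → ∀ N : ℕ, 2 ≤ N → N < p →
      (N : ℝ) ^ 2 / (p * Real.log N ^ 2) ≤ fermatQuotientImageSize p N := by
  have log_ge : ∀ᶠ N : ℕ in atTop, 12 ≤ Real.log N :=
    (Real.tendsto_log_atTop.comp tendsto_natCast_atTop_atTop).eventually_ge_atTop 12
  obtain ⟨N₀, hN₀⟩ := eventually_atTop.1 (log_ge.and
    (eventually_mul_div_log_le_card_primesLE_erase three_fourths_lt_log_div_six 2))
  filter_upwards [eventually_gt_atTop 2, (eventually_all_finset (range N₀)).2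
    fun N _ => eventually_sq_div_mul_sq_log_le_one N] with p hp₂ small_le hp N hN hNp
  rcases lt_or_ge N N₀ with h | h
  · exact (small_le N (mem_range.2 h)).trans
      (mod_cast one_le_fermatQuotientImageSize p (one_le_two.trans hN))
  · exact sq_div_le_fermatQuotientImageSize_of_le_card hp hp₂.ne' hNp (hN₀ N h).1 (hN₀ N h).2

end FermatQuotient

theorem theorem11 :
    ∃ δ : ℕ → ℝ, Filter.Tendsto δ Filter.atTop (nhds 0) ∧
      ∀ p : ℕ, p.Prime → ∀ N : ℕ, 2 ≤ N → N < p →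
        (1 + δ p) * ((N : ℝ) ^ 2 / ((p : ℝ) * (Real.log (N : ℝ)) ^ 2))
          ≤ (fermatQuotientImageSize p N : ℝ) := by
  refine exists_tendsto_of_eventually (P := fun p ε => p.Prime → ∀ N : ℕ, 2 ≤ N → N < p →
    (1 + ε) * ((N : ℝ) ^ 2 / (p * Real.log N ^ 2)) ≤ fermatQuotientImageSize p N) ?_
    fun p => ⟨-1, by simp⟩
  simpa using theorem11_general
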